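/- Let $\mathcal A$ be a finite arrangement of affine hyperplanes in $\mathbb C^\ell$, let $f=\prod_{H\in\mathcal A}\alpha_H$ be a defining polynomial of $\mathcal A$ (each $\alpha_H$ is a polynomial of degree one with zero locus $H$), and let $M(\mathcal A)=\mathbb C^\ell\setminus f^{-1}(0)$. For each positive integer $m$ put \[ X_m(\mathcal A)=\{(\mathbf x,z)\in M(\mathcal A)\times\mathbb C^*\mid f(\mathbf x)=z^m\}, \] with the subspace topology. If $k$ divides $m$, then $H^*(X_k(\mathcal A);\mathbb C)$ is a direct summand of $H^*(X_m(\mathcal A);\mathbb C)$ as a graded complex vector space; more precisely, the map $p_{m,k}:X_m(\mathcal A)\to X_k(\mathcal A)$, $(\mathbf x,z)\mapsto(\mathbf x,z^{m/k})$, induces an injective homomorphism $p_{m,k}^*:H^q(X_k(\mathcal A);\mathbb C)\to H^q(X_m(\mathcal A);\mathbb C)$ in singular cohomology for every $q\ge 0$, and there are complex subspaces $W^q\subseteq H^q(X_m(\mathcal A);\mathbb C)$ with $H^q(X_m(\mathcal A);\mathbb C)=p_{m,k}^*H^q(X_k(\mathcal A);\mathbb C)\oplus W^q$ for every $q\ge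 0$. -/

import Mathlib

/-! ### Singular cohomology with complex coefficients -/

namespace SingularCohomology

/-- A singular `n`-simplex of `X`: a continuous map from the standard topological `n`-simplex. -/
abbrev Simplex (X : Type) [TopologicalSpace X] (n : ℕ) : Type :=
  C(stdSimplex ℝ (Fin (n + 1)), X)

/-- The inclusion of the `i`-th face of the standard `(n + 1)`-simplex
(the face opposite to the `i`-th vertex). -/
noncomputable def faceInclusion (n : ℕ) (i : Fin (n + 2)) :
    C(stdSimplex ℝ (Fin (n + 1)), stdSimplex ℝ (Fin (n + 2))) :=
  ⟨stdSimplex.map i.succAbove, stdSimplex.continuous_map _⟩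

/-- Complex-valued singular `n`-cochains: arbitrary functions on the set of singular `n`-simplices,
i.e. linear forms on the space of singular `n`-chains. -/
abbrev Cochain (X : Type) [TopologicalSpace X] (n : ℕ) : Type :=
  Simplex X n → ℂ

/-- The coboundary `(δ φ)(σ) = ∑ i, (-1) ^ i * φ (σ ∘ faceInclusion i)`. -/
noncomputable def coboundary (X : Type) [TopologicalSpace X] (n : ℕ) :
    Cochain X n →ₗ[ℂ] Cochain X (n + 1) where
  toFun φ σ := ∑ i : Fin (n + 2), (-1 : ℂ) ^ (i : ℕ) * φ (σ.comp (faceInclusion n i))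
  map_add' φ ψ := by
    funext σ
    simp [mul_add, Finset.sum_add_distrib]
  map_smul' c φ := by
    funext σ
    simp [Finset.mul_sum, mul_left_comm]

theorem faceInclusion_comp (n : ℕ) (i : Fin (n + 2)) (j : Fin (n + 3)) (h : (j : ℕ) ≤ (i : ℕ)) :
    (faceInclusion (n + 1) j).comp (faceInclusion n i) =
      (faceInclusion (n + 1) i.succ).comp
        (faceInclusion n (Fin.castLT j (lt_of_le_of_lt h i.isLt))) := by
  ext1 x
  simp only [faceInclusion, ContinuousMap.comp_apply, ContinuousMap.coe_mk,
    stdSimplex.map_comp_apply]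
  congr 1
  funext k
  ext
  simp only [Function.comp_apply, Fin.succAbove, Fin.lt_def]
  split_ifs <;> simp_all <;> omega

/-- The square of the coboundary is zero. -/
theorem coboundary_coboundary (X : Type) [TopologicalSpace X] (n : ℕ) (φ : Cochain X n) :
    coboundary X (n + 1) (coboundary X n φ) = 0 := by
  funext σ
  simp only [coboundary, LinearMap.coe_mk, AddHom.coe_mk, Finset.mul_sum, Pi.zero_apply]
  rw [Finset.sum_comm]
  simp only [← Finset.sum_product']
  let P := Fin (n + 2) × Fin (n + 3)
  let S : Finset P := {ij : P | (ij.2 : ℕ) ≤ (ij.1 : ℕ)}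
  rw [Finset.univ_product_univ, ← Finset.sum_add_sum_compl S, ← eq_neg_iff_add_eq_zero,
    ← Finset.sum_neg_distrib]
  let e : ∀ ij : P, ij ∈ S → P := fun ij hij =>
    (Fin.castLT ij.2 (lt_of_le_of_lt (Finset.mem_filter.mp hij).right (Fin.is_lt ij.1)), ij.1.succ)
  apply Finset.sum_bij e
  · intro ij hij
    simp_rw [S, e, Finset.compl_filter, Finset.mem_filter_univ, Fin.val_succ,
      Fin.val_castLT] at hij ⊢
    omega
  · rintro ⟨i, j⟩ hij ⟨i', j'⟩ hij' h
    have h₁ : (j : ℕ) = j' := congrArg (fun p : P => (p.1 : ℕ)) h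
    have h₂ : (i : ℕ) + 1 = i' + 1 := congrArg (fun p : P => (p.2 : ℕ)) h
    exact Prod.ext (Fin.ext (by simpa using h₂)) (Fin.ext h₁)
  · rintro ⟨i', j'⟩ hij'
    simp_rw [S, Finset.compl_filter, Finset.mem_filter_univ, not_le] at hij'
    refine ⟨(j'.pred ?_, Fin.castSucc i'), ?_, ?_⟩
    · rintro rfl
      simp only [Fin.val_zero, not_lt_zero] at hij'
    · simpa [S] using Nat.le_sub_one_of_lt hij'
    · simp only [e, Fin.castLT_castSucc, Fin.succ_pred]
  · rintro ⟨i, j⟩ hij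
    have h : (j : ℕ) ≤ (i : ℕ) := (Finset.mem_filter.mp hij).right
    simp only [e, Fin.val_succ, Fin.val_castLT, ContinuousMap.comp_assoc,
      faceInclusion_comp n i j h]
    ring

/-- Singular `n`-cocycles. -/
noncomputable def cocycles (X : Type) [TopologicalSpace X] (n : ℕ) : Submodule ℂ (Cochain X n) :=
  LinearMap.ker (coboundary X n)

/-- Singular `n`-coboundaries. -/
noncomputable def coboundaries (X : Type) [TopologicalSpace X] :
    (n : ℕ) → Submodule ℂ (Cochain X n)
  | 0 => ⊥
  | n + 1 => LinearMap.range (coboundary X n)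

theorem coboundaries_le_cocycles (X : Type) [TopologicalSpace X] (n : ℕ) :
    coboundaries X n ≤ cocycles X n := by
  cases n with
  | zero => exact bot_le
  | succ n =>
    rintro _ ⟨φ, rfl⟩
    exact coboundary_coboundary X n φ

/-- The singular cohomology `H ^ n (X; ℂ)`: cocycles modulo coboundaries. -/
abbrev H (X : Type) [TopologicalSpace X] (n : ℕ) : Type :=
  cocycles X n ⧸ (coboundaries X n).submoduleOf (cocycles X n)

/-- Pullback of singular cochains along a continuous map. -/
def cochainMap {X Y : Type} [TopologicalSpace X] [TopologicalSpace Y] (g : C(X, Y)) (n : ℕ) :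
    Cochain Y n →ₗ[ℂ] Cochain X n :=
  LinearMap.funLeft ℂ ℂ fun σ : Simplex X n => g.comp σ

theorem coboundary_cochainMap {X Y : Type} [TopologicalSpace X] [TopologicalSpace Y]
    (g : C(X, Y)) (n : ℕ) (φ : Cochain Y n) :
    coboundary X n (cochainMap g n φ) = cochainMap g (n + 1) (coboundary Y n φ) :=
  rfl

theorem cochainMap_mem_cocycles {X Y : Type} [TopologicalSpace X] [TopologicalSpace Y]
    (g : C(X, Y)) (n : ℕ) (φ : Cochain Y n) (hφ : φ ∈ cocycles Y n) :
    cochainMap g n φ ∈ cocycles X n := by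
  have h : coboundary Y n φ = 0 := hφ
  change coboundary X n (cochainMap g n φ) = 0
  rw [coboundary_cochainMap, h, map_zero]

theorem cochainMap_mem_coboundaries {X Y : Type} [TopologicalSpace X] [TopologicalSpace Y]
    (g : C(X, Y)) (n : ℕ) (φ : Cochain Y n) (hφ : φ ∈ coboundaries Y n) :
    cochainMap g n φ ∈ coboundaries X n := by
  cases n with
  | zero =>
    have h : φ = 0 := hφ
    rw [h, map_zero]
    exact Submodule.zero_mem _
  | succ n =>
    obtain ⟨ψ, rfl⟩ := hφ
    exact ⟨cochainMap g n ψ, coboundary_cochainMap g n ψ⟩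

/-- The homomorphism `g^* : H ^ n (Y; ℂ) → H ^ n (X; ℂ)` induced by a continuous map
`g : X → Y`. -/
noncomputable def map {X Y : Type} [TopologicalSpace X] [TopologicalSpace Y] (g : C(X, Y))
    (n : ℕ) : H Y n →ₗ[ℂ] H X n :=
  Submodule.mapQ _ _
    ((cochainMap g n).restrict (cochainMap_mem_cocycles g n))
    (fun φ hφ => cochainMap_mem_coboundaries g n φ hφ)

end SingularCohomology

/-! ### Affine hyperplane arrangements and their cyclic covers -/

/-- A (finite) arrangement of affine hyperplanes in `ℂ ^ ℓ`.  An affine hyperplane is the zero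
locus of a polynomial of degree one. -/
structure AffineArrangement (ℓ : ℕ) where
  hyperplanes : Finset (Set (Fin ℓ → ℂ))
  isHyperplane : ∀ H ∈ hyperplanes, ∃ α : MvPolynomial (Fin ℓ) ℂ,
    α.totalDegree = 1 ∧ H = {x | MvPolynomial.eval x α = 0}

namespace AffineArrangement

variable {ℓ : ℕ}

/-- `f` is a defining polynomial of the arrangement: a product, over the hyperplanes `H`, of
polynomials of degree one with zero locus `H`. (It is unique up to a nonzero constant factor if
the arrangement is nonempty; for the empty arrangement it is the empty product `1`.) -/
def IsDefiningPolynomial (A : AffineArrangement ℓ) (f : MvPolynomial (Fin ℓ) ℂ) : Prop :=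
  ∃ α : Set (Fin ℓ → ℂ) → MvPolynomial (Fin ℓ) ℂ,
    (∀ H ∈ A.hyperplanes, (α H).totalDegree = 1 ∧ H = {x | MvPolynomial.eval x (α H) = 0}) ∧
      f = ∏ H ∈ A.hyperplanes, α H

theorem exists_isDefiningPolynomial (A : AffineArrangement ℓ) :
    ∃ f, A.IsDefiningPolynomial f := by
  classical
  choose! α hα using A.isHyperplane
  exact ⟨_, α, hα, rfl⟩

end AffineArrangement

/-- The space `X_m = {(x, z) ∈ M × ℂ^* | f(x) = z ^ m}`, where `M = ℂ ^ ℓ ∖ f⁻¹(0)`, with the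
subspace topology from `ℂ ^ ℓ × ℂ`. -/
abbrev CyclicCover {ℓ : ℕ} (f : MvPolynomial (Fin ℓ) ℂ) (m : ℕ) : Type :=
  {p : (Fin ℓ → ℂ) × ℂ // MvPolynomial.eval p.1 f ≠ 0 ∧ p.2 ≠ 0 ∧
    MvPolynomial.eval p.1 f = p.2 ^ m}

/-- For `m = k * r`, the covering `p_{m,k} : X_m → X_k`, `(x, z) ↦ (x, z ^ r)`. -/
def CyclicCover.proj {ℓ : ℕ} (f : MvPolynomial (Fin ℓ) ℂ) {k m : ℕ} (h : k ∣ m) :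
    C(CyclicCover f m, CyclicCover f k) where
  toFun p := ⟨(p.1.1, p.1.2 ^ (m / k)), p.2.1, pow_ne_zero _ p.2.2.1, by
    rw [← pow_mul, Nat.div_mul_cancel h]
    exact p.2.2.2⟩
  continuous_toFun := by fun_prop

/-! Put `r = m / k`. The group of `r`-th roots of unity acts on `X_m` by `z ↦ ζ z` over `X_k`, and a
transfer for this action splits `p^*` up to a nonzero scalar. On cochains, the transfer sums over
the translates of a lifted simplex; it commutes with the coboundary, and composed after `p^*` it is
multiplication by the group order, invertible in `ℂ`. Hence `p^*` is injective, and a complement of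
its range is linear algebra.

The topological input is that simplices lift along `p` and that the group permutes the lifts
transitively. Since `p` is the pullback of `z ↦ z ^ r` on `ℂ^*` along the coordinate `z`, both facts
reduce to that covering. -/

/-! ### Lifting maps from contractible spaces -/

/-- A map from a contractible space to the base of a surjective covering map lifts. -/
theorem IsCoveringMap.exists_lift_of_contractibleSpace {E B A : Type*} [TopologicalSpace E]
    [TopologicalSpace B] [TopologicalSpace A] [ContractibleSpace A] {p : E → B}
    (cov : IsCoveringMap p) (hp : Function.Surjective p) (f : C(A, B)) :
    ∃ F : C(A, E), p ∘ F = f := by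
  obtain ⟨a, ⟨h⟩⟩ := id_nullhomotopic A
  obtain ⟨e, he⟩ := hp (f a)
  -- The contraction is reversed so that it starts at a constant map, whose lift is just a point of
  -- the fibre; the lifted homotopy at time 1 then lifts `f`.
  let K : C(unitInterval × A, B) := f.comp h.symm.toContinuousMap
  have hK : ∀ x, K (0, x) = p (ContinuousMap.const A e x) := fun x => by
    simp [K, he]
  let L := cov.liftHomotopy K (ContinuousMap.const A e) hK
  refine ⟨L.comp ⟨fun x => (1, x), by fun_prop⟩, ?_⟩
  funext x
  have := congrFun (cov.liftHomotopy_lifts K (ContinuousMap.const A e) hK) (1, x)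
  simpa [K, L] using this

theorem contractibleSpace_stdSimplex (n : ℕ) :
    ContractibleSpace (stdSimplex ℝ (Fin (n + 1))) :=
  (convex_stdSimplex ℝ (Fin (n + 1))).contractibleSpace
    (Set.nonempty_coe_sort.mp inferInstance)

/-! ### The transfer of a finite Galois covering -/

namespace SingularCohomology

section Transfer

variable {X Y G : Type} [TopologicalSpace X] [TopologicalSpace Y] [Fintype G]

/-- The sum of the values of a cochain over the translates of a simplex. -/
noncomputable def orbitSum (ρ : G → C(X, X)) (n : ℕ) (φ : Cochain X n) (τ : Simplex X n) : ℂ :=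
  ∑ g, φ ((ρ g).comp τ)

theorem orbitSum_comp [Group G] {ρ : G → C(X, X)}
    (hρ : ∀ g h, ρ (g * h) = (ρ g).comp (ρ h)) {n : ℕ}
    (φ : Cochain X n) (g : G) (τ : Simplex X n) :
    orbitSum ρ n φ ((ρ g).comp τ) = orbitSum ρ n φ τ := by
  unfold orbitSum
  simp_rw [← ContinuousMap.comp_assoc, ← hρ]
  exact Fintype.sum_equiv (Equiv.mulRight g) _ (fun h => φ ((ρ h).comp τ)) fun _ => rfl

/-- The transfer of a cochain along `p`: its value at a simplex of the base is the sum of the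
values of the cochain over the translates of a lift of the simplex. -/
noncomputable def transfer (ρ : G → C(X, X)) {p : C(X, Y)}
    (hlift : ∀ n (σ : Simplex Y n), ∃ τ : Simplex X n, p.comp τ = σ) (n : ℕ)
    (φ : Cochain X n) : Cochain Y n :=
  fun σ => orbitSum ρ n φ (hlift n σ).choose

/-- The chosen lift does not matter: any other is a translate of it, and orbit sums are invariant.
-/
theorem transfer_comp [Group G] {ρ : G → C(X, X)}
    (hρ : ∀ g h, ρ (g * h) = (ρ g).comp (ρ h)) {p : C(X, Y)}
    (hlift : ∀ n (σ : Simplex Y n), ∃ τ : Simplex X n, p.comp τ = σ)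
    (htrans : ∀ n (τ τ' : Simplex X n), p.comp τ = p.comp τ' → ∃ g, τ' = (ρ g).comp τ) {n : ℕ}
    (φ : Cochain X n) (τ : Simplex X n) :
    transfer ρ hlift n φ (p.comp τ) = orbitSum ρ n φ τ := by
  obtain ⟨g, hg⟩ := htrans n τ _ (hlift n (p.comp τ)).choose_spec.symm
  rw [transfer, hg, orbitSum_comp hρ]

/-- The faces of a lift are lifts of the faces, so by `transfer_comp` one lift of `σ` computes both
sides. -/
theorem coboundary_transfer [Group G] {ρ : G → C(X, X)}
    (hρ : ∀ g h, ρ (g * h) = (ρ g).comp (ρ h))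
    {p : C(X, Y)} (hlift : ∀ n (σ : Simplex Y n), ∃ τ : Simplex X n, p.comp τ = σ)
    (htrans : ∀ n (τ τ' : Simplex X n), p.comp τ = p.comp τ' → ∃ g, τ' = (ρ g).comp τ) (n : ℕ)
    (φ : Cochain X n) :
    coboundary Y n (transfer ρ hlift n φ) = transfer ρ hlift (n + 1) (coboundary X n φ) := by
  funext σ
  obtain ⟨τ, rfl⟩ := hlift (n + 1) σ
  rw [transfer_comp hρ hlift htrans]
  simp only [coboundary, LinearMap.coe_mk, AddHom.coe_mk, ContinuousMap.comp_assoc,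
    transfer_comp hρ hlift htrans, orbitSum]
  rw [Finset.sum_comm]
  simp only [Finset.mul_sum]

theorem transfer_cochainMap {ρ : G → C(X, X)} {p : C(X, Y)} (hp : ∀ g, p.comp (ρ g) = p)
    (hlift : ∀ n (σ : Simplex Y n), ∃ τ : Simplex X n, p.comp τ = σ) (n : ℕ) (φ : Cochain Y n) :
    transfer ρ hlift n (cochainMap p n φ) = (Fintype.card G : ℂ) • φ := by
  funext σ
  simp [transfer, orbitSum, cochainMap, LinearMap.funLeft_apply, ← ContinuousMap.comp_assoc, hp,
    (hlift n σ).choose_spec]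

/-- A map `p` whose simplices lift, with the lifts of a simplex permuted transitively by a finite
group of automorphisms of `X` over `Y`, is injective in complex cohomology. -/
theorem map_injective_of_transfer [Group G] {ρ : G → C(X, X)}
    (hρ : ∀ g h, ρ (g * h) = (ρ g).comp (ρ h))
    {p : C(X, Y)} (hp : ∀ g, p.comp (ρ g) = p)
    (hlift : ∀ n (σ : Simplex Y n), ∃ τ : Simplex X n, p.comp τ = σ)
    (htrans : ∀ n (τ τ' : Simplex X n), p.comp τ = p.comp τ' → ∃ g, τ' = (ρ g).comp τ) (n : ℕ) :
    Function.Injective (map p n) := by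
  have hcard : (Fintype.card G : ℂ) ≠ 0 := Nat.cast_ne_zero.mpr Fintype.card_ne_zero
  rw [injective_iff_map_eq_zero]
  intro c hc
  obtain ⟨φ, rfl⟩ := Submodule.Quotient.mk_surjective _ c
  have h : cochainMap p n φ.1 ∈ coboundaries X n :=
    (Submodule.Quotient.mk_eq_zero ((coboundaries X n).submoduleOf (cocycles X n))).mp hc
  refine (Submodule.Quotient.mk_eq_zero _).mpr ?_
  change φ.1 ∈ coboundaries Y n
  rw [← (coboundaries Y n).smul_mem_iff hcard, ← transfer_cochainMap hp hlift]
  -- Coboundaries in degree 0 are `⊥` by definition, so there is no primitive to transfer there.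
  cases n with
  | zero =>
    have h0 : cochainMap p 0 φ.1 = 0 := h
    have h1 : transfer ρ hlift 0 (cochainMap p 0 φ.1) = 0 := by
      funext σ
      simp [transfer, orbitSum, h0]
    rw [h1]
    exact Submodule.zero_mem _
  | succ n =>
    obtain ⟨ψ, hψ⟩ := h
    rw [← hψ, ← coboundary_transfer hρ hlift htrans]
    exact ⟨_, rfl⟩

end Transfer

end SingularCohomology

/-! ### The deck transformations of `X_m → X_k` -/

namespace CyclicCover

variable {ℓ : ℕ} (f : MvPolynomial (Fin ℓ) ℂ) {k m : ℕ}

/-- The deck transformation `(x, z) ↦ (x, ζ z)` given by a root of unity `ζ`. -/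
def deck (h : k ∣ m) (ζ : rootsOfUnity (m / k) ℂ) : C(CyclicCover f m, CyclicCover f m) where
  toFun p := ⟨(p.1.1, ((ζ : ℂˣ) : ℂ) * p.1.2), p.2.1, mul_ne_zero (Units.ne_zero _) p.2.2.1, by
    have hζ : ((ζ : ℂˣ) : ℂ) ^ (m / k) = 1 := (mem_rootsOfUnity' _ _).mp ζ.2
    have hζm : ((ζ : ℂˣ) : ℂ) ^ m = 1 := by
      -- Since `m / k` divides `m`, `ζ` is also an `m`-th root of unity.
      obtain ⟨j, hj⟩ := Nat.div_dvd_of_dvd h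
      exact (congrArg (((ζ : ℂˣ) : ℂ) ^ ·) hj).trans (by simp only [pow_mul, hζ, one_pow])
    rw [mul_pow, hζm, one_mul]
    exact p.2.2.2⟩
  continuous_toFun := by fun_prop

theorem deck_mul (h : k ∣ m) (ζ ξ : rootsOfUnity (m / k) ℂ) :
    deck f h (ζ * ξ) = (deck f h ζ).comp (deck f h ξ) := by
  ext1 p
  exact Subtype.ext (Prod.ext rfl (by simp [deck, mul_assoc]))

theorem proj_comp_deck (h : k ∣ m) (ζ : rootsOfUnity (m / k) ℂ) :
    (proj f h).comp (deck f h ζ) = proj f h := by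
  have hζ : ((ζ : ℂˣ) : ℂ) ^ (m / k) = 1 := (mem_rootsOfUnity' _ _).mp ζ.2
  ext1 p
  exact Subtype.ext (Prod.ext rfl (by simp [deck, proj, mul_pow, hζ]))

/-- The punctured-plane coordinate `(x, z) ↦ z`. -/
def coord (m : ℕ) : C(CyclicCover f m, {z : ℂ // z ≠ 0}) where
  toFun p := ⟨p.1.2, p.2.2.1⟩
  continuous_toFun := by fun_prop

/-- Only the `z`-coordinate has to be lifted, through the power map of `ℂ^*`; the `x`-coordinate is
kept. -/
theorem exists_proj_comp_eq (h : k ∣ m) (hm : 0 < m) {A : Type*} [TopologicalSpace A]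
    [ContractibleSpace A] (σ : C(A, CyclicCover f k)) :
    ∃ τ : C(A, CyclicCover f m), (proj f h).comp τ = σ := by
  have hr : m / k ≠ 0 := (Nat.div_pos (Nat.le_of_dvd hm h) (Nat.pos_of_dvd_of_pos h hm)).ne'
  obtain ⟨w, hw⟩ := (isCoveringMap_npow (𝕜 := ℂ) (m / k)
    (Nat.cast_ne_zero.mpr hr)).exists_lift_of_contractibleSpace (fun z => by
      obtain ⟨y, hy⟩ := IsAlgClosed.exists_pow_nat_eq z.1 (Nat.pos_of_ne_zero hr)
      exact ⟨⟨y, fun hy0 => z.2 (by rw [← hy, hy0, zero_pow hr])⟩, Subtype.ext hy⟩)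
    ((coord f k).comp σ)
  have hw' : ∀ a, (w a).1 ^ (m / k) = (σ a).1.2 := fun a => congrArg Subtype.val (congrFun hw a)
  refine ⟨⟨fun a => ⟨((σ a).1.1, (w a).1), (σ a).2.1, (w a).2, ?_⟩, by fun_prop⟩, ?_⟩
  · rw [(σ a).2.2.2, ← hw', ← pow_mul, Nat.div_mul_cancel h]
  · ext1 a
    exact Subtype.ext (Prod.ext rfl (hw' a))

/-- The ratio of the `z`-coordinates at one point is a root of unity `ζ`; uniqueness of lifts on a
connected space spreads the equality from that point to all of `A`. -/
theorem exists_eq_deck_comp (h : k ∣ m) (hm : 0 < m) {A : Type*} [TopologicalSpace A]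
    [PreconnectedSpace A] [Nonempty A] (τ τ' : C(A, CyclicCover f m))
    (hτ : (proj f h).comp τ = (proj f h).comp τ') : ∃ ζ, τ' = (deck f h ζ).comp τ := by
  have hr : m / k ≠ 0 := (Nat.div_pos (Nat.le_of_dvd hm h) (Nat.pos_of_dvd_of_pos h hm)).ne'
  have : NeZero (m / k) := ⟨hr⟩
  have hval : ∀ a, ((τ a).1.1, (τ a).1.2 ^ (m / k)) = ((τ' a).1.1, (τ' a).1.2 ^ (m / k)) :=
    fun a => congrArg Subtype.val (DFunLike.congr_fun hτ a)
  obtain ⟨a₀⟩ := ‹Nonempty A›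
  have hpow : ((τ' a₀).1.2 / (τ a₀).1.2) ^ (m / k) = 1 := by
    rw [div_pow, div_eq_one_iff_eq (pow_ne_zero _ (τ a₀).2.2.1)]
    exact (Prod.ext_iff.mp (hval a₀)).2.symm
  let ζ := rootsOfUnity.mkOfPowEq _ hpow
  have hζ : ((ζ : ℂˣ) : ℂ) * (τ a₀).1.2 = (τ' a₀).1.2 := by
    rw [rootsOfUnity.coe_mkOfPowEq, div_mul_cancel₀ _ (τ a₀).2.2.1]
  have hcoord : (coord f m).comp τ' = (coord f m).comp ((deck f h ζ).comp τ) := by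
    refine DFunLike.coe_injective ((isCoveringMap_npow (𝕜 := ℂ) (m / k)
      (Nat.cast_ne_zero.mpr hr)).eq_of_comp_eq (ContinuousMap.continuous _)
      (ContinuousMap.continuous _) ?_ a₀ (Subtype.ext hζ.symm))
    funext a
    have hdeck := congrArg Subtype.val (DFunLike.congr_fun (proj_comp_deck f h ζ) (τ a))
    exact Subtype.ext ((Prod.ext_iff.mp (hval a)).2.symm.trans (Prod.ext_iff.mp hdeck).2.symm)
  refine ⟨ζ, ?_⟩
  ext1 a
  exact Subtype.ext (Prod.ext (Prod.ext_iff.mp (hval a)).1.symm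
    (congrArg Subtype.val (DFunLike.congr_fun hcoord a)))

/-- The covering `X_m → X_k` is injective in singular cohomology with complex coefficients. -/
theorem map_proj_injective (h : k ∣ m) (hm : 0 < m) (q : ℕ) :
    Function.Injective (SingularCohomology.map (proj f h) q) := by
  have hr : m / k ≠ 0 := (Nat.div_pos (Nat.le_of_dvd hm h) (Nat.pos_of_dvd_of_pos h hm)).ne'
  have : NeZero (m / k) := ⟨hr⟩
  have := contractibleSpace_stdSimplex
  have := Fintype.ofFinite (rootsOfUnity (m / k) ℂ)
  exact SingularCohomology.map_injective_of_transfer (deck_mul f h) (proj_comp_deck f h)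
    (fun _ σ => exists_proj_comp_eq f h hm σ) (fun _ => exists_eq_deck_comp f h hm) q

end CyclicCover

/-- If `k` divides `m`, then `H^*(X_k; ℂ)` is a direct summand of `H^*(X_m; ℂ)` as a graded complex
vector space, embedded by the homomorphism induced by the covering `p_{m,k} : X_m → X_k`. -/
theorem theorem4p4 {ℓ : ℕ} (A : AffineArrangement ℓ) (f : MvPolynomial (Fin ℓ) ℂ)
    (hf : A.IsDefiningPolynomial f) (k m : ℕ) (hm : 0 < m) (hkm : k ∣ m) :
    ∃ W : (q : ℕ) → Submodule ℂ (SingularCohomology.H (CyclicCover f m) q),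
      ∀ q : ℕ,
        Function.Injective (SingularCohomology.map (CyclicCover.proj f hkm) q) ∧
        IsCompl (LinearMap.range (SingularCohomology.map (CyclicCover.proj f hkm) q)) (W q) := by
  choose W hW using fun q : ℕ => Submodule.exists_isCompl
    (LinearMap.range (SingularCohomology.map (CyclicCover.proj f hkm) q))
  exact ⟨W, fun q => ⟨CyclicCover.map_proj_injective f hkm hm q, hW q⟩⟩
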